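/- Let $X$ be a $T_0$ topological space with specialization order $x\sqsubseteq y\iff x\in\overline{\{y\}}$, and write $\uparrow y=\{x: y\sqsubseteq x\}$. A $T_0$ space $X$ is called a \emph{c-space} if for every $x\in X$ and every open neighbourhood $U$ of $x$ there is $y\in U$ with $x\in\operatorname{int}(\uparrow y)\subseteq U$. A \emph{simple valuation} on $X$ is a function $\xi=\sum_{b\in B}r_b\eta_b$ from the open sets of $X$ to $[0,+\infty]$, where $B\subseteq X$ is finite (possibly empty), $0<r_b<+\infty$ for $b\in B$, and $\eta_b(U)=1$ if $b\in U$, $\eta_b(U)=0$ otherwise. Simple valuations are ordered pointwise: $\xi\le\zeta$ iff $\xi(U)\le\zeta(U)$ for all open $U$. Directed sets are nonempty. A directed set $D\subseteq X$ (for $\sqsubseteq$) converges to $x\in X$, written $D\to x$, if it does so as a net indexed by itself. For a directed set $\mathcal D$ of simple valuations and a simple valuation $\xi=\sum_{b\in B}r_b\eta_b$, write $\mathcal D\Rightarrow_P\xi$ if there are directed sets $D_b\subseteq X$ with $D_b\to b$ $(b\in B)$ such that for all $d_b\in D_b$ and all $0\le r'_b<r_b$ $(b\in B)$ there is $\xi'\in\mathcal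 D$ with $\sum_{b\in B}r'_b\eta_{d_b}\le\xi'$. Let $CX$ (the directed probabilistic powerspace of $X$) be the set of all simple valuations on $X$ with the topology in which $\mathcal U$ is open iff, for every directed set $\mathcal D$ of simple valuations and every simple valuation $\xi$, $\mathcal D\Rightarrow_P\xi\in\mathcal U$ implies $\mathcal D\cap\mathcal U\neq\emptyset$. \textbf{Theorem.} If $X$ is a c-space, then $CX$ is a c-space. -/

import Mathlib

open scoped NNReal ENNReal

namespace DirectedPowerspace

open TopologicalSpace

section Order

variable {X : Type*} [TopologicalSpace X]

/-- The specialization order `x ⊑ y`, that is, `x` lies in the closure of `{y}`. -/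
def SpecLE (x y : X) : Prop := x ∈ closure ({y} : Set X)

/-- The principal upper set `↑y` of the specialization order. -/
def upper (y : X) : Set X := {x | SpecLE y x}

/-- Directed subsets for the specialization order; they are nonempty. -/
def IsDirectedSet (D : Set X) : Prop := D.Nonempty ∧ DirectedOn SpecLE D

/-- `D → x`: the set `D`, seen as a net indexed by itself under the specialization order,
is eventually in every open neighbourhood of `x`. -/
def ConvergesTo (D : Set X) (x : X) : Prop :=
  ∀ U : Set X, IsOpen U → x ∈ U → ∃ d ∈ D, ∀ e ∈ D, SpecLE d e → e ∈ U

end Order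

/-- c-spaces: `T₀` spaces in which every open neighbourhood `U` of a point `x` contains a point
`y` with `x ∈ interior (↑y) ⊆ U`. -/
structure IsCSpace (X : Type*) [TopologicalSpace X] : Prop where
  t0 : T0Space X
  exists_mem_interior_upper : ∀ (x : X) (U : Set X), IsOpen U → x ∈ U →
    ∃ y ∈ U, x ∈ interior (upper y) ∧ interior (upper y) ⊆ U

section Valuations

variable {X : Type*} [TopologicalSpace X]

/-- The point valuation `η_x`: its value at `U` is `1` if `x ∈ U` and `0` otherwise. -/
noncomputable def pointValuation (x : X) : Opens X → ℝ≥0∞ :=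
  fun U => Set.indicator (U : Set X) 1 x

/-- `μ = ∑_{b ∈ B} r_b η_b`, with `0 < r_b < ∞` for all `b` in the finite set `B`. -/
def IsSumOver (μ : Opens X → ℝ≥0∞) (B : Finset X) (r : X → ℝ≥0) : Prop :=
  (∀ b ∈ B, 0 < r b) ∧ μ = ∑ b ∈ B, r b • pointValuation b

end Valuations

/-- Simple valuations on `X`. They are functions on the lattice of open sets, and the empty sum,
the zero valuation, is one of them. -/
@[ext]
structure SimpleValuation (X : Type*) [TopologicalSpace X] where
  toFun : Opens X → ℝ≥0∞
  isSimple : ∃ (B : Finset X) (r : X → ℝ≥0), IsSumOver toFun B r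

namespace SimpleValuation

variable {X : Type*} [TopologicalSpace X]

/-- The pointwise order. -/
instance : PartialOrder (SimpleValuation X) :=
  PartialOrder.lift SimpleValuation.toFun (fun _ _ h => SimpleValuation.ext h)

/-- The relation `𝒟 ⇒_P ξ`, for `ξ = ∑_{b ∈ B} r_b η_b` with support `B`: there are directed sets
`E_b → b` in `X`, for `b ∈ B`, such that whenever `d_b ∈ E_b` and `r'_b < r_b` for all `b ∈ B`,
some member of `𝒟` lies above `∑_{b ∈ B} r'_b η_{d_b}`. (In a `T₀` space the representation of
`ξ` is unique.) -/
def ConvergesP (D : Set (SimpleValuation X)) (ξ : SimpleValuation X) : Prop :=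
  ∃ (B : Finset X) (r : X → ℝ≥0), IsSumOver ξ.toFun B r ∧
    ∃ E : X → Set X, (∀ b ∈ B, IsDirectedSet (E b) ∧ ConvergesTo (E b) b) ∧
      ∀ d : X → X, (∀ b ∈ B, d b ∈ E b) →
        ∀ r' : X → ℝ≥0, (∀ b ∈ B, r' b < r b) →
          ∃ ξ' ∈ D, ∑ b ∈ B, r' b • pointValuation (d b) ≤ ξ'.toFun

/-- The `⇒_P` convergence open sets of simple valuations. -/
def IsOpenP (𝒰 : Set (SimpleValuation X)) : Prop :=
  ∀ (D : Set (SimpleValuation X)) (ξ : SimpleValuation X),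
    D.Nonempty → DirectedOn (· ≤ ·) D → ConvergesP D ξ → ξ ∈ 𝒰 → (D ∩ 𝒰).Nonempty

theorem convergesP_singleton {ξ ζ : SimpleValuation X} (h : ξ ≤ ζ) : ConvergesP {ζ} ξ := by
  obtain ⟨B, r, hr⟩ := ξ.isSimple
  refine ⟨B, r, hr, fun b => {b}, ?_, ?_⟩
  · intro b _
    refine ⟨⟨Set.singleton_nonempty b, ?_⟩, ?_⟩
    · rintro x rfl y rfl
      exact ⟨y, rfl, subset_closure rfl, subset_closure rfl⟩
    · intro U _ hb
      refine ⟨b, rfl, ?_⟩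
      rintro e rfl _
      exact hb
  · intro d hd r' hr'
    refine ⟨ζ, rfl, le_trans ?_ h⟩
    rw [hr.2]
    refine Finset.sum_le_sum fun b hb => ?_
    have hdb : d b = b := hd b hb
    rw [hdb]
    intro U
    exact mul_le_mul_left (ENNReal.coe_le_coe.2 (hr' b hb).le) _

theorem IsOpenP.mem_of_le {𝒰 : Set (SimpleValuation X)} (h𝒰 : IsOpenP 𝒰)
    {ξ ζ : SimpleValuation X} (h : ξ ≤ ζ) (hξ : ξ ∈ 𝒰) : ζ ∈ 𝒰 := by
  obtain ⟨x, hx, hx'⟩ := h𝒰 {ζ} ξ (Set.singleton_nonempty ζ)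
    (by rintro x rfl y rfl; exact ⟨y, rfl, le_rfl, le_rfl⟩) (convergesP_singleton h) hξ
  rw [Set.mem_singleton_iff] at hx
  exact hx ▸ hx'

end SimpleValuation

/-- The space `CX`: the set of simple valuations on `X`, with the `⇒_P` convergence open sets
as its topology. -/
instance SimpleValuation.instTopologicalSpace {X : Type*} [TopologicalSpace X] :
    TopologicalSpace (SimpleValuation X) where
  IsOpen := SimpleValuation.IsOpenP
  isOpen_univ := fun D _ hD _ _ _ => by simpa using hD
  isOpen_inter := by
    intro 𝒰 𝒱 h𝒰 h𝒱 D ξ hne hdir hconv hξ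
    obtain ⟨x, hxD, hx⟩ := h𝒰 D ξ hne hdir hconv hξ.1
    obtain ⟨y, hyD, hy⟩ := h𝒱 D ξ hne hdir hconv hξ.2
    obtain ⟨z, hzD, hxz, hyz⟩ := hdir x hxD y hyD
    exact ⟨z, hzD, h𝒰.mem_of_le hxz hx, h𝒱.mem_of_le hyz hy⟩
  isOpen_sUnion := by
    rintro S hS D ξ hne hdir hconv ⟨𝒰, h𝒰, hξ⟩
    obtain ⟨x, hxD, hx⟩ := hS 𝒰 h𝒰 D ξ hne hdir hconv hξ
    exact ⟨x, hxD, 𝒰, h𝒰, hx⟩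

/-- The directed probabilistic powerspace `CX` of `X`. -/
abbrev PowerSpace (X : Type*) [TopologicalSpace X] : Type _ := SimpleValuation X

end DirectedPowerspace

namespace DirectedPowerspace

open TopologicalSpace

section Order

variable {X : Type*} [TopologicalSpace X]

/-! Given `ξ = ∑ r_b η_b` in an open `𝒰`, the sums `∑ r'_b η_{d_b}` with `r'_b < r_b` and `b ∈
interior (↑d_b)` form a directed family that `⇒_P`-converges to `ξ`, so one of them, `ζ`, lies in
`𝒰` (`exists_ofSum_mem`). Lying above `ζ` is implied by finitely many strict lower bounds on values
at open sets. These bounds are open conditions and hold at `ξ`, so `ξ ∈ interior (↑ζ)`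
(`mem_interior_upper_ofSum`). -/

theorem SpecLE.mem_of_isOpen {x y : X} (h : SpecLE x y) {U : Set X} (hU : IsOpen U)
    (hx : x ∈ U) : y ∈ U :=
  (specializes_iff_mem_closure.2 h).mem_open hU hx

theorem upper_subset_of_isOpen {y : X} {U : Set X} (hU : IsOpen U) (hy : y ∈ U) :
    upper y ⊆ U :=
  fun _ hx => SpecLE.mem_of_isOpen hx hU hy

/-- In a c-space, the points `y` with `x ∈ interior (↑y)` form a directed set. -/
theorem IsCSpace.isDirectedSet_below (hX : IsCSpace X) (x : X) :
    IsDirectedSet {y : X | x ∈ interior (upper y)} := by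
  constructor
  · obtain ⟨y, -, hy, -⟩ := hX.exists_mem_interior_upper x Set.univ isOpen_univ trivial
    exact ⟨y, hy⟩
  · intro y hy z hz
    obtain ⟨w, hw, hxw, -⟩ := hX.exists_mem_interior_upper x
      (interior (upper y) ∩ interior (upper z)) (isOpen_interior.inter isOpen_interior) ⟨hy, hz⟩
    exact ⟨w, hxw, interior_subset (s := upper y) hw.1, interior_subset (s := upper z) hw.2⟩

/-- In a c-space, the points `y` with `x ∈ interior (↑y)` converge to `x`. -/
theorem IsCSpace.convergesTo_below (hX : IsCSpace X) (x : X) :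
    ConvergesTo {y : X | x ∈ interior (upper y)} x := by
  intro U hU hxU
  obtain ⟨y, hyU, hy, -⟩ := hX.exists_mem_interior_upper x U hU hxU
  exact ⟨y, hy, fun e _ he => he.mem_of_isOpen hU hyU⟩

theorem ConvergesTo.exists_mem {D : Set X} {x : X} (h : ConvergesTo D x) {U : Set X}
    (hU : IsOpen U) (hx : x ∈ U) : ∃ d ∈ D, d ∈ U := by
  obtain ⟨d, hd, hdU⟩ := h U hU hx
  exact ⟨d, hd, hdU d hd (subset_closure rfl)⟩

end Order

section Valuations

variable {X : Type*} [TopologicalSpace X]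

theorem pointValuation_monotone (x : X) : Monotone (pointValuation x) :=
  fun _ _ h => Set.indicator_le_indicator_of_subset h (fun _ => zero_le) x

theorem SpecLE.pointValuation_le {x y : X} (h : SpecLE x y) :
    pointValuation x ≤ pointValuation y := by
  intro U
  by_cases hx : x ∈ (U : Set X)
  · simp [pointValuation, hx, h.mem_of_isOpen U.isOpen hx]
  · simp [pointValuation, hx]

open Classical in
theorem sum_smul_pointValuation_apply (B : Finset X) (r : X → ℝ≥0) (d : X → X) (U : Opens X) :
    (∑ b ∈ B, r b • pointValuation (d b)) U
      = ((∑ b ∈ B with d b ∈ U, r b : ℝ≥0) : ℝ≥0∞) := by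
  rw [Finset.sum_apply, Finset.sum_filter, ENNReal.ofNNReal_finsetSum]
  refine Finset.sum_congr rfl fun b _ => ?_
  by_cases h : d b ∈ U <;> simp [pointValuation, h, ENNReal.smul_def]

theorem sum_smul_pointValuation_mono {B : Finset X} {r s : X → ℝ≥0} {d e : X → X}
    (hrs : ∀ b ∈ B, r b ≤ s b) (hde : ∀ b ∈ B, SpecLE (d b) (e b)) :
    ∑ b ∈ B, r b • pointValuation (d b) ≤ ∑ b ∈ B, s b • pointValuation (e b) :=
  Finset.sum_le_sum fun b hb U =>
    mul_le_mul' (ENNReal.coe_le_coe.2 (hrs b hb)) ((hde b hb).pointValuation_le U)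

/-- Nonnegative finite combinations of point valuations, possibly with zero coefficients and
repeated points, are simple valuations. -/
theorem exists_isSumOver_sum (B : Finset X) (r : X → ℝ≥0) (d : X → X) :
    ∃ (A : Finset X) (s : X → ℝ≥0), IsSumOver (∑ b ∈ B, r b • pointValuation (d b)) A s := by
  classical
  -- Coefficients at coinciding points are merged; points of total weight zero are then dropped.
  let s : X → ℝ≥0 := fun a => ∑ b ∈ B with d b = a, r b
  refine ⟨{a ∈ B.image d | s a ≠ 0}, s, fun a ha => pos_iff_ne_zero.2 (Finset.mem_filter.1 ha).2,
    ?_⟩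
  rw [Finset.sum_filter_of_ne (p := fun a => s a ≠ 0) (fun a _ h hs => h (by rw [hs, zero_smul])),
    ← Finset.sum_fiberwise_of_maps_to (fun b hb => Finset.mem_image_of_mem d hb)]
  refine Finset.sum_congr rfl fun a _ => ?_
  rw [Finset.sum_smul]
  exact Finset.sum_congr rfl fun b hb => by rw [(Finset.mem_filter.1 hb).2]

end Valuations

namespace SimpleValuation

variable {X : Type*} [TopologicalSpace X]

/-- The simple valuation `∑_{b ∈ B} r_b η_{d_b}`. -/
noncomputable def ofSum (B : Finset X) (r : X → ℝ≥0) (d : X → X) : SimpleValuation X :=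
  ⟨∑ b ∈ B, r b • pointValuation (d b), exists_isSumOver_sum B r d⟩

theorem toFun_monotone (ξ : SimpleValuation X) : Monotone ξ.toFun := by
  obtain ⟨B, r, -, h⟩ := ξ.isSimple
  rw [h]
  intro U V hUV
  simp only [Finset.sum_apply]
  exact Finset.sum_le_sum fun b _ => mul_le_mul' le_rfl (pointValuation_monotone b hUV)

/-- These open sets separate points, giving `T₀`, and supply the neighbourhoods inside `↑ζ`. -/
theorem isOpen_setOf_lt_toFun (c : ℝ≥0∞) (U : Opens X) :
    IsOpen {τ : SimpleValuation X | c < τ.toFun U} := by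
  classical
  intro D τ _ _ hconv hτ
  obtain ⟨B, r, ⟨hr, hsum⟩, E, hE, hD⟩ := hconv
  have hτU : c < ((∑ b ∈ B with b ∈ U, r b : ℝ≥0) : ℝ≥0∞) := by
    have hU := sum_smul_pointValuation_apply B r id U
    simp only [id] at hU
    rw [← hU, ← hsum]
    exact hτ
  lift c to ℝ≥0 using hτU.ne_top
  have hc := ENNReal.coe_lt_coe.1 hτU
  -- Scaling by `t < 1` puts every coefficient strictly below `r b` while the mass on `U` stays
  -- above `c`.
  obtain ⟨t, hct, ht⟩ := exists_between ((div_lt_one (pos_of_gt hc)).2 hc)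
  rw [div_lt_iff₀ (pos_of_gt hc), Finset.mul_sum] at hct
  have hd : ∀ b, ∃ d, b ∈ B → d ∈ E b ∧ (b ∈ U → d ∈ U) := by
    intro b
    by_cases hb : b ∈ B
    · by_cases hbU : b ∈ U
      · obtain ⟨d, hd, hdU⟩ := (hE b hb).2.exists_mem U.isOpen hbU
        exact ⟨d, fun _ => ⟨hd, fun _ => hdU⟩⟩
      · obtain ⟨d, hd⟩ := (hE b hb).1.1
        exact ⟨d, fun _ => ⟨hd, fun h => absurd h hbU⟩⟩
    · exact ⟨b, fun h => absurd h hb⟩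
  choose d hd using hd
  obtain ⟨ξ', hξ', hle⟩ := hD d (fun b hb => (hd b hb).1) (fun b => t * r b)
    (fun b hb => mul_lt_of_lt_one_left (hr b hb) ht)
  refine ⟨ξ', hξ', lt_of_lt_of_le ?_ (hle U)⟩
  rw [sum_smul_pointValuation_apply]
  refine ENNReal.coe_lt_coe.2 (hct.trans_le (Finset.sum_le_sum_of_subset ?_))
  intro b hb
  rw [Finset.mem_filter] at hb ⊢
  exact ⟨hb.1, (hd b hb.1).2 hb.2⟩

theorem t0Space : T0Space (SimpleValuation X) := by
  refine ⟨fun ξ ζ h => ?_⟩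
  by_contra hne
  obtain ⟨U, hU⟩ := Function.ne_iff.1 (fun h => hne (SimpleValuation.ext h))
  rcases lt_or_gt_of_ne hU with hlt | hlt
  · exact lt_irrefl (ξ.toFun U) ((h.mem_open_iff (isOpen_setOf_lt_toFun (ξ.toFun U) U)).2 hlt)
  · exact lt_irrefl (ζ.toFun U) ((h.mem_open_iff (isOpen_setOf_lt_toFun (ζ.toFun U) U)).1 hlt)

theorem specLE_of_le {ξ ζ : SimpleValuation X} (h : ξ ≤ ζ) : SpecLE ξ ζ :=
  mem_closure_iff.2 fun _ hU hξ => ⟨ζ, IsOpenP.mem_of_le hU h hξ, rfl⟩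

/-- In a c-space, an open set of simple valuations containing `∑_{b ∈ B} r_b η_b` contains some
`∑_{b ∈ B} r'_b η_{d_b}` with `r'_b < r_b` and `b ∈ interior (↑d_b)`. -/
theorem exists_ofSum_mem (hX : IsCSpace X) {𝒰 : Set (SimpleValuation X)} (h𝒰 : IsOpen 𝒰)
    {ξ : SimpleValuation X} (hξ : ξ ∈ 𝒰) {B : Finset X} {r : X → ℝ≥0}
    (hr : IsSumOver ξ.toFun B r) :
    ∃ (r' : X → ℝ≥0) (d : X → X), (∀ b ∈ B, r' b < r b) ∧
      (∀ b ∈ B, b ∈ interior (upper (d b))) ∧ ofSum B r' d ∈ 𝒰 := by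
  let D : Set (SimpleValuation X) :=
    {ζ | ∃ (r' : X → ℝ≥0) (d : X → X), (∀ b ∈ B, r' b < r b) ∧
      (∀ b ∈ B, b ∈ interior (upper (d b))) ∧ ζ = ofSum B r' d}
  have hne : D.Nonempty := by
    choose d hd using fun b => (hX.isDirectedSet_below b).1
    -- Zero coefficients are admissible since each `r b` is positive.
    exact ⟨_, fun _ => 0, d, hr.1, fun b _ => hd b, rfl⟩
  have hdir : DirectedOn (· ≤ ·) D := by
    rintro _ ⟨r₁, d₁, hr₁, hd₁, rfl⟩ _ ⟨r₂, d₂, hr₂, hd₂, rfl⟩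
    have he : ∀ b, ∃ e, b ∈ B →
        b ∈ interior (upper e) ∧ SpecLE (d₁ b) e ∧ SpecLE (d₂ b) e := by
      intro b
      by_cases hb : b ∈ B
      · obtain ⟨e, he, h₁, h₂⟩ :=
          (hX.isDirectedSet_below b).2 (d₁ b) (hd₁ b hb) (d₂ b) (hd₂ b hb)
        exact ⟨e, fun _ => ⟨he, h₁, h₂⟩⟩
      · exact ⟨b, fun h => absurd h hb⟩
    choose e he using he
    exact ⟨_, ⟨fun b => max (r₁ b) (r₂ b), e, fun b hb => max_lt (hr₁ b hb) (hr₂ b hb),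
        fun b hb => (he b hb).1, rfl⟩,
      sum_smul_pointValuation_mono (fun b _ => le_max_left _ _) (fun b hb => (he b hb).2.1),
      sum_smul_pointValuation_mono (fun b _ => le_max_right _ _) (fun b hb => (he b hb).2.2)⟩
  have hconv : ConvergesP D ξ :=
    ⟨B, r, hr, fun b => {y | b ∈ interior (upper y)},
      fun b _ => ⟨hX.isDirectedSet_below b, hX.convergesTo_below b⟩,
      fun d hd r' hr' => ⟨ofSum B r' d, ⟨r', d, hr', hd, rfl⟩, le_rfl⟩⟩
  obtain ⟨_, ⟨r', d, hr', hd, rfl⟩, hmem⟩ := h𝒰 D ξ hne hdir hconv hξ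
  exact ⟨r', d, hr', hd, hmem⟩

/-- The open set `⋃_{b ∈ A} interior (↑d_b)`. -/
def iSupInteriorUpper (A : Finset X) (d : X → X) : Opens X :=
  ⨆ b ∈ A, ⟨interior (upper (d b)), isOpen_interior⟩

theorem mem_iSupInteriorUpper {A : Finset X} {d : X → X} {b : X} (hb : b ∈ A) {x : X}
    (hx : x ∈ interior (upper (d b))) : x ∈ iSupInteriorUpper A d :=
  (le_iSup₂_of_le (f := fun b (_ : b ∈ A) =>
    (⟨interior (upper (d b)), isOpen_interior⟩ : Opens X)) b hb le_rfl) hx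

theorem iSupInteriorUpper_le {A : Finset X} {d : X → X} {U : Opens X}
    (h : ∀ b ∈ A, d b ∈ U) : iSupInteriorUpper A d ≤ U :=
  iSup₂_le fun b hb => interior_subset.trans (upper_subset_of_isOpen U.isOpen (h b hb))

/-- At an open `U` the sum depends only on `A = {b ∈ B | d b ∈ U}`, and `U` contains
`iSupInteriorUpper A d`; hence finitely many sets test the order. Empty `A` is excluded, as the
strict bound would fail there. -/
theorem ofSum_le_of_forall {B : Finset X} {r : X → ℝ≥0} {d : X → X} {τ : SimpleValuation X}
    (h : ∀ A ⊆ B, A.Nonempty →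
      ((∑ b ∈ A, r b : ℝ≥0) : ℝ≥0∞) < τ.toFun (iSupInteriorUpper A d)) :
    ofSum B r d ≤ τ := by
  classical
  intro U
  change (∑ b ∈ B, r b • pointValuation (d b)) U ≤ _
  rw [sum_smul_pointValuation_apply]
  rcases Finset.eq_empty_or_nonempty {b ∈ B | d b ∈ U} with hA | hA
  · simp [hA]
  · exact (h _ (Finset.filter_subset _ _) hA).le.trans
      (τ.toFun_monotone (iSupInteriorUpper_le fun b hb => (Finset.mem_filter.1 hb).2))

theorem mem_interior_upper_ofSum {ξ : SimpleValuation X} {B : Finset X} {r r' : X → ℝ≥0}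
    {d : X → X} (hr : IsSumOver ξ.toFun B r) (hr' : ∀ b ∈ B, r' b < r b)
    (hd : ∀ b ∈ B, b ∈ interior (upper (d b))) :
    ξ ∈ interior (upper (ofSum B r' d)) := by
  classical
  let 𝒱 : Set (SimpleValuation X) := ⋂ A ∈ B.powerset.filter Finset.Nonempty,
    {τ | ((∑ b ∈ A, r' b : ℝ≥0) : ℝ≥0∞) < τ.toFun (iSupInteriorUpper A d)}
  have hmem : ∀ τ, τ ∈ 𝒱 ↔ ∀ A ⊆ B, A.Nonempty →
      ((∑ b ∈ A, r' b : ℝ≥0) : ℝ≥0∞) < τ.toFun (iSupInteriorUpper A d) := by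
    simp [𝒱]
  refine mem_interior.2 ⟨𝒱, fun τ hτ => specLE_of_le (ofSum_le_of_forall ((hmem τ).1 hτ)),
    isOpen_biInter_finset fun A _ => isOpen_setOf_lt_toFun _ _, (hmem ξ).2 fun A hAB hA => ?_⟩
  have hξ := sum_smul_pointValuation_apply B r id (iSupInteriorUpper A d)
  rw [hr.2]
  refine lt_of_lt_of_eq (ENNReal.coe_lt_coe.2 ?_) hξ.symm
  -- Strictness needs `A` nonempty; each `b ∈ A` lies in the test set because `b ∈ interior (↑d_b)`.
  refine (Finset.sum_lt_sum_of_nonempty hA fun b hb => hr' b (hAB hb)).trans_le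
    (Finset.sum_le_sum_of_subset fun b hb => ?_)
  exact Finset.mem_filter.2 ⟨hAB hb, mem_iSupInteriorUpper hb (hd b (hAB hb))⟩

end SimpleValuation

end DirectedPowerspace

theorem mainTheorem5 {X : Type*} [TopologicalSpace X]
    (hX : DirectedPowerspace.IsCSpace X) :
    DirectedPowerspace.IsCSpace (DirectedPowerspace.PowerSpace X) := by
  refine ⟨DirectedPowerspace.SimpleValuation.t0Space, fun ξ 𝒰 h𝒰 hξ => ?_⟩
  obtain ⟨B, r, hr⟩ := ξ.isSimple
  obtain ⟨r', d, hr', hd, hmem⟩ :=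
    DirectedPowerspace.SimpleValuation.exists_ofSum_mem hX h𝒰 hξ hr
  exact ⟨_, hmem, DirectedPowerspace.SimpleValuation.mem_interior_upper_ofSum hr hr' hd,
    interior_subset.trans (DirectedPowerspace.upper_subset_of_isOpen h𝒰 hmem)⟩
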